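/- **Setting.** Let $f:\mathbb R^n\to\mathbb R$ be continuously differentiable and convex, let $g:\mathbb R^m\to\mathbb R\cup\{+\infty\}$ be proper, lower semicontinuous and convex, and let $c:\mathbb R^n\to\mathbb R^m$ be continuously differentiable and such that $$c(\lambda x+(1-\lambda)x')-\lambda c(x)-(1-\lambda)c(x')\in \operatorname{hzn} g\qquad(x,x'\in\mathbb R^n,\ \lambda\in[0,1]),$$ where $\operatorname{hzn} g:=\{v\mid g(z+v)\le g(z)\ \forall z\in\operatorname{dom} g\}$. Consider the problem of minimizing $\Phi:=f+g\circ c$ over $\mathbb R^n$. Let $\Phi^*$ be its minimal value. For $x \in\mathbb R^n$ let $\mathcal Y(x):=\{y\in\partial g(c(x))\mid \nabla f(x)+c'(x)^\top y=0\}$. Suppose that there is a stationary minimizer, i.e. a point $x^\ast$ with $\Phi(x^\ast)=\Phi^*<\infty$ and $\mathcal Y(x^\ast)\neq\emptyset$, and put $Y_{\rm mul}:=\mathcal Y(x^\ast)$. For $\mu>0$ let $$\mathcal L_\mu(x,y):=f(x)+g^\mu(c(x)+\mu y)-\tfrac\mu2\|y\|^2,\qquad g^\mu(w):=\inf_v\{g(v)+\tfrac1{2\mu}\|v-w\|^2\}.$$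 **Algorithm.** Data: $y^0\in\mathbb R^m$, $\mu_0>0$, a nonempty convex compact set $Y_{\rm sg}\subseteq\mathbb R^m$, $\theta,\eta\in(0,1)$, $\beta\in(\eta^2,\eta)$. Set $\rho_0:=1$, $V^{-1}:=\infty$. For $k=0,1,2,\dots$: 1. $\hat y^k$ is the projection of $y^k$ onto $\rho_kY_{\rm sg}$. 2. Select $\varepsilon_k\ge0$ and $x^k$ with $\mathcal L_{\mu_k}(x^k,\hat y^k)\le\inf_x\mathcal L_{\mu_k}(x,\hat y^k)+\varepsilon_k$. 3. $z^k:=\operatorname{prox}_{\mu_kg}(c(x^k)+\mu_k\hat y^k)$, $V^k:=\|c(x^k)-z^k\|_\infty$, $y^{k+1}:=\hat y^k+\mu_k^{-1}(c(x^k)-z^k)$. 4. If $V^k\le\theta V^{k-1}$, set $\mu_{k+1}:=\mu_k$, $\rho_{k+1}:=\rho_k$; otherwise set $\mu_{k+1}:=\beta\mu_k$, $\rho_{k+1}:=(\eta/\beta)\rho_k$. **Theorem.** Let the sequences be generated by this algorithm and suppose that $\sum_{k=0}^\infty\sqrt{\varepsilon_k/\mu_k}<\infty$. Then: (a) Suppose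 that, in case $\mu_k\to0$, every $\bar y\in Y_{\rm mul}$ belongs to $rY_{\rm sg}$ for all sufficiently large $r>0$ (which always holds if $0$ is an interior point of $Y_{\rm sg}$). Then the whole sequence $\{y^k\}$ converges to an element of $Y_{\rm mul}$. (b) $c(x^k)-z^k\to0$ and $\limsup_{k\to\infty}\,(f(x^k)+g(z^k))\le\Phi^*$. (c) Every accumulation point of $\{x^k\}$ is a minimizer of $\Phi$. (d) If a subsequence $\{x^k\}_{k\in K}$ converges to $\bar x$, then $z^k\to c(\bar x)$ and $f(x^k)+g(z^k)\to\Phi^*$ along $K$. -/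

import Mathlib

open Filter Topology
open scoped Pointwise

noncomputable section

namespace CompositeALM

/-- `ℝⁿ` with the Euclidean inner product and norm. -/
abbrev Vec (n : ℕ) : Type := EuclideanSpace ℝ (Fin n)

/-! ### Extended-real-valued convex functions -/

/-- The extended-real-valued function `φ` is proper: it never takes the value `-∞`, and its domain
is nonempty. -/
def IsProper {m : ℕ} (φ : Vec m → EReal) : Prop :=
  (∀ z, φ z ≠ ⊥) ∧ ∃ z, φ z ≠ ⊤

/-- Convexity of an extended-real-valued function: its epigraph is a convex set. -/
def IsConvexFun {m : ℕ} (φ : Vec m → EReal) : Prop :=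
  Convex ℝ {p : Vec m × ℝ | φ p.1 ≤ (p.2 : EReal)}

/-- The horizon `hzn φ = {v | φ (z + v) ≤ φ z for all z ∈ dom φ}`. -/
def hzn {m : ℕ} (φ : Vec m → EReal) : Set (Vec m) :=
  {v | ∀ z, φ z ≠ ⊤ → φ (z + v) ≤ φ z}

/-- The convex subdifferential of `φ` at `z₀`; it is empty outside of the domain of `φ`. -/
def subdifferential {m : ℕ} (φ : Vec m → EReal) (z₀ : Vec m) : Set (Vec m) :=
  {y | φ z₀ ≠ ⊤ ∧ ∀ z, φ z₀ + ((inner ℝ y (z - z₀) : ℝ) : EReal) ≤ φ z}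

/-- The function `w ↦ φ w + (1 / (2 γ)) ‖w - z‖²`. -/
def proxObjective {m : ℕ} (φ : Vec m → EReal) (γ : ℝ) (z w : Vec m) : EReal :=
  φ w + ((1 / (2 * γ) * ‖w - z‖ ^ 2 : ℝ) : EReal)

/-- The Moreau envelope `φ^γ`. -/
def moreauEnvelope {m : ℕ} (φ : Vec m → EReal) (γ : ℝ) (z : Vec m) : EReal :=
  ⨅ w, proxObjective φ γ z w

/-- `p = prox_{γ φ}(z)`: the point `p` minimizes `φ + (1 / (2 γ)) ‖· - z‖²`. (For `γ > 0` and
proper, lower semicontinuous, convex `φ` there is exactly one such point.) -/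
def IsProx {m : ℕ} (φ : Vec m → EReal) (γ : ℝ) (z p : Vec m) : Prop :=
  ∀ w, proxObjective φ γ z p ≤ proxObjective φ γ z w

/-- `p` is the projection of `y` onto `C`. -/
def IsProj {m : ℕ} (C : Set (Vec m)) (y p : Vec m) : Prop :=
  p ∈ C ∧ ∀ w ∈ C, ‖p - y‖ ≤ ‖w - y‖

/-! ### The composite problem: minimize `Φ x = f x + g (c x)` -/

/-- The objective `Φ = f + g ∘ c`. -/
def objective {n m : ℕ} (f : Vec n → ℝ) (g : Vec m → EReal) (c : Vec n → Vec m) (x : Vec n) :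
    EReal :=
  (f x : EReal) + g (c x)

/-- The minimal value `Φ*`. -/
def optimalValue {n m : ℕ} (f : Vec n → ℝ) (g : Vec m → EReal) (c : Vec n → Vec m) : EReal :=
  ⨅ x, objective f g c x

/-- `x` is a (global, feasible) minimizer of the problem. -/
def IsMinimizer {n m : ℕ} (f : Vec n → ℝ) (g : Vec m → EReal) (c : Vec n → Vec m) (x : Vec n) :
    Prop :=
  objective f g c x ≠ ⊤ ∧ ∀ x', objective f g c x ≤ objective f g c x'

/-- The set of multipliers associated with `x`: all `y ∈ ∂g(c x)` with
`∇ₓ L(x, y) = ∇f(x) + c'(x)ᵀ y = 0`. -/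
def multipliers {n m : ℕ} (f : Vec n → ℝ) (g : Vec m → EReal) (c : Vec n → Vec m) (x : Vec n) :
    Set (Vec m) :=
  {y | y ∈ subdifferential g (c x) ∧
    gradient f x + ContinuousLinearMap.adjoint (fderiv ℝ c x) y = 0}

/-- `x` is a stationary point of the problem, i.e., a multiplier exists at `x`. -/
def IsStationary {n m : ℕ} (f : Vec n → ℝ) (g : Vec m → EReal) (c : Vec n → Vec m) (x : Vec n) :
    Prop :=
  (multipliers f g c x).Nonempty

/-- The standing assumptions on a fully convex composite problem. -/
structure FullyConvex {n m : ℕ} (f : Vec n → ℝ) (g : Vec m → EReal) (c : Vec n → Vec m) :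
    Prop where
  f_contDiff : ContDiff ℝ 1 f
  f_convex : ConvexOn ℝ Set.univ f
  g_proper : IsProper g
  g_lsc : LowerSemicontinuous g
  g_convex : IsConvexFun g
  c_contDiff : ContDiff ℝ 1 c
  /-- `c` is convex with respect to the cone `-hzn g`. -/
  c_convex : ∀ (x x' : Vec n) (t : ℝ), 0 ≤ t → t ≤ 1 →
    c (t • x + (1 - t) • x') - t • c x - (1 - t) • c x' ∈ hzn g
  exists_minimizer : ∃ x, IsMinimizer f g c x

/-- The augmented Lagrangian `L_μ(x, y) = f x + g^μ (c x + μ y) - (μ / 2) ‖y‖²`. -/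
def augLagrangian {n m : ℕ} (f : Vec n → ℝ) (g : Vec m → EReal) (c : Vec n → Vec m) (μ : ℝ)
    (x : Vec n) (y : Vec m) : EReal :=
  (f x : EReal) + moreauEnvelope g μ (c x + μ • y) - ((μ / 2 * ‖y‖ ^ 2 : ℝ) : EReal)

/-! ### The augmented Lagrangian method with elastic safeguard -/

/-- The maximum norm of a vector in `ℝᵐ` (the norm of the underlying function `Fin m → ℝ`). -/
def maxNorm {m : ℕ} (v : Vec m) : ℝ := ‖WithLp.ofLp v‖

/-- The acceptance test `V^k ≤ θ V^{k-1}` in iteration `k`, where `V^{-1} = ∞`; hence the test is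
always passed in iteration `0`. -/
def Accepts (θ : ℝ) (V : ℕ → ℝ) (k : ℕ) : Prop :=
  k = 0 ∨ V k ≤ θ * V (k - 1)

/-- The sequences `x, z, y, yhat` (iterates), `ε` (inner tolerances), `μ` (penalty parameters) and
`ρ` (scaling factors of the safeguarding set) are generated by the augmented Lagrangian method with
elastic safeguard, run with safeguarding set `Ysg` and parameters `θ, η, β`. The starting point is
`y 0`, the initial penalty parameter is `μ 0`. -/
structure IsElasticALMRun {n m : ℕ} (f : Vec n → ℝ) (g : Vec m → EReal) (c : Vec n → Vec m)
    (Ysg : Set (Vec m)) (θ η β : ℝ) (x : ℕ → Vec n) (z y yhat : ℕ → Vec m) (ε μ ρ : ℕ → ℝ) :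
    Prop where
  rho_zero : ρ 0 = 1
  safeguard : ∀ k, IsProj (ρ k • Ysg) (y k) (yhat k)
  eps_nonneg : ∀ k, 0 ≤ ε k
  subproblem : ∀ k, augLagrangian f g c (μ k) (x k) (yhat k) ≤
    (⨅ x', augLagrangian f g c (μ k) x' (yhat k)) + (ε k : EReal)
  prox_step : ∀ k, IsProx g (μ k) (c (x k) + μ k • yhat k) (z k)
  dual_step : ∀ k, y (k + 1) = yhat k + (μ k)⁻¹ • (c (x k) - z k)
  accept : ∀ k, Accepts θ (fun j => maxNorm (c (x j) - z j)) k →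
    μ (k + 1) = μ k ∧ ρ (k + 1) = ρ k
  reject : ∀ k, ¬ Accepts θ (fun j => maxNorm (c (x j) - z j)) k →
    μ (k + 1) = β * μ k ∧ ρ (k + 1) = η / β * ρ k

end CompositeALM

end

/-! Treat `x` and the argument `v` of `g` as joint variables coupled by `c x = v`. Then `y` is a
multiplier exactly when the Lagrangian f(x) + g(v) + ⟨y, c(x) - v⟩ is bounded below by Φ*
(`mem_multipliers_iff`), a condition that is closed in `y`; and the subproblem minimizes this
Lagrangian plus ‖c(x) - v‖²/(2μ) (`approx_min_joint`).

Write r = c(x^k) - z^k. Comparison with x* gives ⟨ŷ - ȳ, r⟩ + ‖r‖²/(2μ) ≤ ε for every multiplier ȳ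
(`penalty_gap_le`). This controls r and makes the dual step quasi-Fejér: ‖y^{k+1} - ȳ‖² ≤ ‖ŷ^k - ȳ‖²
+ 2ε/μ. By `approx_min_lagrangian`, (x^k, z^k) nearly minimizes the Lagrangian at y^{k+1}, with an
error governed by √(ε/μ); hence dual cluster points are multipliers once r → 0.

After finitely many rejections μ and ρ freeze, r decays geometrically and the dual sequences are
Cauchy. Under infinitely many rejections μρ → 0 and μρ² → 0, which yields feasibility and
optimality; the duals converge by quasi-Fejér monotonicity once the growing safeguard contains each
multiplier. -/

namespace CompositeALM

/-! ### Extended-real convex functions and their horizon. -/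

section Convex

variable {m : ℕ} {g : Vec m → EReal}

theorem IsProper.coe_toReal (hg : IsProper g) {v : Vec m} (hv : g v ≠ ⊤) :
    ((g v).toReal : EReal) = g v :=
  EReal.coe_toReal hv (hg.1 v)

theorem ne_top_of_le_coe {a : EReal} {b : ℝ} (h : a ≤ b) : a ≠ ⊤ :=
  (h.trans_lt (EReal.coe_lt_top b)).ne

theorem IsProper.toReal_le (hg : IsProper g) {v : Vec m} {b : ℝ} (h : g v ≤ b) :
    (g v).toReal ≤ b := by
  rw [← EReal.coe_le_coe_iff, hg.coe_toReal (ne_top_of_le_coe h)]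
  exact h

theorem IsConvexFun.le_combo (hg : IsProper g) (hc : IsConvexFun g) {u v : Vec m}
    (hu : g u ≠ ⊤) (hv : g v ≠ ⊤) {t : ℝ} (h0 : 0 ≤ t) (h1 : t ≤ 1) :
    g (t • u + (1 - t) • v) ≤ ((t * (g u).toReal + (1 - t) * (g v).toReal : ℝ) : EReal) :=
  hc (x := (u, (g u).toReal)) (hg.coe_toReal hu).ge (y := (v, (g v).toReal))
    (hg.coe_toReal hv).ge h0 (sub_nonneg.2 h1) (by ring)

theorem subdifferential_le_toReal (hg : IsProper g) {z₀ y v : Vec m}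
    (hy : y ∈ subdifferential g z₀) (hv : g v ≠ ⊤) :
    (g z₀).toReal + inner ℝ y (v - z₀) ≤ (g v).toReal := by
  have h := hy.2 v
  rw [← hg.coe_toReal hy.1, ← hg.coe_toReal hv] at h
  exact_mod_cast h

/-- The subgradient inequality at `z₀ + h` bounds the inner product by g(z₀ + h) - g(z₀), which is
nonpositive along the horizon. -/
theorem inner_nonpos_of_mem_hzn (hg : IsProper g) {z₀ y h : Vec m}
    (hy : y ∈ subdifferential g z₀) (hh : h ∈ hzn g) : inner ℝ y h ≤ 0 := by
  have h1 := hh z₀ hy.1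
  rw [← hg.coe_toReal hy.1] at h1
  have h2 := hg.toReal_le h1
  have h3 := subdifferential_le_toReal hg hy (ne_top_of_le_coe h1)
  rw [add_sub_cancel_left] at h3
  linarith

end Convex

/-- A convex function with vanishing derivative at a point attains its minimum there. -/
theorem le_of_convexOn_of_hasFDerivAt_zero {E : Type*} [NormedAddCommGroup E] [NormedSpace ℝ E]
    {F : E → ℝ} (hF : ConvexOn ℝ Set.univ F) {a : E} (hd : HasFDerivAt F (0 : E →L[ℝ] ℝ) a)
    (b : E) : F a ≤ F b := by
  have hline : HasDerivAt (fun t : ℝ => a + t • (b - a)) (b - a) 0 := by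
    simpa using ((hasDerivAt_id (0 : ℝ)).smul_const (b - a)).const_add a
  have hcomp : HasDerivAt (fun t : ℝ => F (a + t • (b - a))) 0 0 := by
    have h : HasFDerivAt F (0 : E →L[ℝ] ℝ) (a + (0 : ℝ) • (b - a)) := by simpa using hd
    exact h.comp_hasDerivAt (0 : ℝ) hline
  -- Chord slopes at `a` towards `b` are at most `F b - F a` by convexity, and they tend to the
  -- derivative 0.
  have ht := hcomp.tendsto_slope_zero_right
  refine sub_nonneg.1 (le_of_tendsto ht ?_)
  filter_upwards [Ioo_mem_nhdsGT (zero_lt_one' ℝ)] with t ht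
  have h := hF.2 (Set.mem_univ b) (Set.mem_univ a) ht.1.le (sub_nonneg.2 ht.2.le) (by ring)
  have he : t • b + (1 - t) • a = a + t • (b - a) := by module
  rw [he, smul_eq_mul, smul_eq_mul] at h
  have h2 : F (a + t • (b - a)) - F a ≤ t * (F b - F a) := by linarith
  simp only [zero_add, zero_smul, add_zero, smul_eq_mul]
  rw [inv_mul_le_iff₀ ht.1]
  exact h2

/-! ### Multipliers as dual solutions. -/

section Problem

variable {n m : ℕ} {f : Vec n → ℝ} {g : Vec m → EReal} {c : Vec n → Vec m}

theorem hasFDerivAt_lagrangian (hP : FullyConvex f g c) (x : Vec n) (y : Vec m) :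
    HasFDerivAt (fun x => f x + inner ℝ y (c x))
      (innerSL ℝ (gradient f x + ContinuousLinearMap.adjoint (fderiv ℝ c x) y)) x := by
  have hf : HasFDerivAt f (fderiv ℝ f x) x :=
    (hP.f_contDiff.differentiable one_ne_zero x).hasFDerivAt
  have hc : HasFDerivAt c (fderiv ℝ c x) x :=
    (hP.c_contDiff.differentiable one_ne_zero x).hasFDerivAt
  refine (hf.add ((innerSL ℝ y).hasFDerivAt.comp x hc)).congr_fderiv ?_
  ext d
  simp [ContinuousLinearMap.adjoint_inner_left, gradient]

/-- The convexity defect of `c` lies in `hzn g`, where a subgradient is nonpositive; so `⟨y, c ·⟩`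
is convex. -/
theorem convexOn_lagrangian (hP : FullyConvex f g c) {x₀ : Vec m} {y : Vec m}
    (hy : y ∈ subdifferential g x₀) : ConvexOn ℝ Set.univ (fun x => f x + inner ℝ y (c x)) := by
  refine hP.f_convex.add ⟨convex_univ, fun a _ b _ t s ht hs hts => ?_⟩
  obtain rfl : s = 1 - t := by linarith
  have h := inner_nonpos_of_mem_hzn hP.g_proper hy (hP.c_convex a b t ht (by linarith))
  rw [inner_sub_right, inner_sub_right, inner_smul_right, inner_smul_right] at h
  simp only [smul_eq_mul]
  linarith

/-- A multiplier is a point at which the dual function attains the primal value. -/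
theorem mem_multipliers_iff (hP : FullyConvex f g c) {xs : Vec n} (hxs : g (c xs) ≠ ⊤)
    {y : Vec m} :
    y ∈ multipliers f g c xs ↔ ∀ x v, g v ≠ ⊤ →
      f xs + (g (c xs)).toReal ≤ f x + (g v).toReal + inner ℝ y (c x - v) := by
  constructor
  · rintro ⟨hy, hgrad⟩ x v hv
    have hd := hasFDerivAt_lagrangian hP xs y
    rw [hgrad, map_zero] at hd
    have h1 := le_of_convexOn_of_hasFDerivAt_zero (convexOn_lagrangian hP hy) hd x
    have h2 := subdifferential_le_toReal hP.g_proper hy hv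
    simp only [inner_sub_right] at h1 h2 ⊢
    linarith
  · intro h
    refine ⟨⟨hxs, fun v => ?_⟩, ?_⟩
    · by_cases hv : g v = ⊤
      · simp [hv]
      · rw [← hP.g_proper.coe_toReal hxs, ← hP.g_proper.coe_toReal hv]
        -- Fixing `x = xs` leaves the subgradient inequality; fixing `v = c xs` below leaves
        -- minimality in `x`.
        have := h xs v hv
        rw [← neg_sub v, inner_neg_right] at this
        have h' : (g (c xs)).toReal + inner ℝ y (v - c xs) ≤ (g v).toReal := by linarith
        exact_mod_cast h'
    · have hmin : IsLocalMin (fun x => f x + inner ℝ y (c x)) xs := by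
        refine Eventually.of_forall fun x => ?_
        have := h x (c xs) hxs
        simp only [inner_sub_right] at this ⊢
        linarith
      have h0 := hmin.hasFDerivAt_eq_zero (hasFDerivAt_lagrangian hP xs y)
      have h1 := congrArg (fun T => T (gradient f xs +
        ContinuousLinearMap.adjoint (fderiv ℝ c xs) y)) h0
      simpa only [innerSL_apply_apply, zero_apply, inner_self_eq_zero] using h1

theorem optimalValue_eq (hP : FullyConvex f g c) {xs : Vec n} (hxs : IsMinimizer f g c xs) :
    g (c xs) ≠ ⊤ ∧ optimalValue f g c = ((f xs + (g (c xs)).toReal : ℝ) : EReal) := by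
  have hv : g (c xs) ≠ ⊤ := fun h => hxs.1 (by simp [objective, h])
  refine ⟨hv, ?_⟩
  rw [EReal.coe_add, hP.g_proper.coe_toReal hv]
  exact le_antisymm (iInf_le _ xs) (le_iInf hxs.2)

end Problem

/-! ### Estimates for a single iteration. -/

section Step

variable {n m : ℕ} {f : Vec n → ℝ} {g : Vec m → EReal} {c : Vec n → Vec m}

theorem IsProx.ne_top (hg : IsProper g) {γ : ℝ} {w p : Vec m} (h : IsProx g γ w p) :
    g p ≠ ⊤ := by
  obtain ⟨v, hv⟩ := hg.2
  intro hp
  have h1 := h v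
  rw [proxObjective, proxObjective, hp, EReal.top_add_coe, top_le_iff,
    ← hg.coe_toReal hv, ← EReal.coe_add] at h1
  exact EReal.coe_ne_top _ h1

theorem IsProx.moreauEnvelope_eq {γ : ℝ} {w p : Vec m} (h : IsProx g γ w p) :
    moreauEnvelope g γ w = proxObjective g γ w p :=
  le_antisymm (iInf_le _ p) (le_iInf h)

/-- Completing the square: the shifted prox term of `augLagrangian` is a linear multiplier term plus
a quadratic penalty. -/
theorem prox_quadratic_expand {μ : ℝ} (hμ : 0 < μ) (a v y : Vec m) :
    1 / (2 * μ) * ‖v - (a + μ • y)‖ ^ 2 - μ / 2 * ‖y‖ ^ 2 =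
      inner ℝ y (a - v) + 1 / (2 * μ) * ‖a - v‖ ^ 2 := by
  have : v - (a + μ • y) = -((a - v) + μ • y) := by module
  rw [this, norm_neg, norm_add_sq_real, norm_smul, inner_smul_right, Real.norm_of_nonneg hμ.le,
    real_inner_comm]
  field_simp
  ring

/-- Approximate minimality for the augmented Lagrangian, in the joint variables `(x, v)`. -/
theorem approx_min_joint (hg : IsProper g) {μ ε : ℝ} (hμ : 0 < μ) {x : Vec n} {y z : Vec m}
    (hsub : augLagrangian f g c μ x y ≤ (⨅ x', augLagrangian f g c μ x' y) + (ε : EReal))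
    (hz : IsProx g μ (c x + μ • y) z) (x' : Vec n) {v : Vec m} (hv : g v ≠ ⊤) :
    f x + (g z).toReal + inner ℝ y (c x - z) + 1 / (2 * μ) * ‖c x - z‖ ^ 2 ≤
      f x' + (g v).toReal + inner ℝ y (c x' - v) + 1 / (2 * μ) * ‖c x' - v‖ ^ 2 + ε := by
  have h1 : augLagrangian f g c μ x' y ≤
      ((f x' + (g v).toReal + inner ℝ y (c x' - v) + 1 / (2 * μ) * ‖c x' - v‖ ^ 2 : ℝ) :
        EReal) := by
    have h2 : moreauEnvelope g μ (c x' + μ • y) ≤ proxObjective g μ (c x' + μ • y) v :=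
      iInf_le _ v
    have h3 : augLagrangian f g c μ x' y ≤
        (f x' : EReal) + proxObjective g μ (c x' + μ • y) v - ((μ / 2 * ‖y‖ ^ 2 : ℝ) : EReal) :=
      EReal.sub_le_sub (add_le_add le_rfl h2) le_rfl
    refine h3.trans (le_of_eq ?_)
    rw [proxObjective, ← hg.coe_toReal hv, ← EReal.coe_add, ← EReal.coe_add, ← EReal.coe_sub,
      EReal.coe_eq_coe_iff, EReal.toReal_coe]
    have := prox_quadratic_expand hμ (c x') v y
    linarith
  have h4 : augLagrangian f g c μ x y =
      ((f x + (g z).toReal + inner ℝ y (c x - z) + 1 / (2 * μ) * ‖c x - z‖ ^ 2 : ℝ) :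
        EReal) := by
    rw [augLagrangian, hz.moreauEnvelope_eq, proxObjective, ← hg.coe_toReal (hz.ne_top hg),
      ← EReal.coe_add, ← EReal.coe_add, ← EReal.coe_sub, EReal.coe_eq_coe_iff, EReal.toReal_coe]
    have := prox_quadratic_expand hμ (c x) z y
    linarith
  have h5 := hsub.trans (add_le_add (iInf_le _ x') le_rfl)
  rw [h4] at h5
  have h6 := h5.trans (add_le_add h1 le_rfl)
  exact_mod_cast h6

/-- Passing to the updated multiplier removes the quadratic penalty from the minimality estimate. -/
theorem approx_min_lagrangian (hP : FullyConvex f g c) {μ ε τ : ℝ} (hμ : 0 < μ) {x : Vec n}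
    {y z : Vec m}
    (hsub : augLagrangian f g c μ x y ≤ (⨅ x', augLagrangian f g c μ x' y) + (ε : EReal))
    (hz : IsProx g μ (c x + μ • y) z) (hτ : 0 < τ) (hετ : ε ≤ μ * τ ^ 2) (hτ1 : μ * τ ≤ 1)
    (x' : Vec n) {v : Vec m} (hv : g v ≠ ⊤) :
    f x + (g z).toReal + inner ℝ (y + μ⁻¹ • (c x - z)) (c x - z) ≤
      f x' + (g v).toReal + inner ℝ (y + μ⁻¹ • (c x - z)) (c x' - v)
        + τ * (1 + ‖(c x' - v) - (c x - z)‖ ^ 2 / 2) := by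
  have hg := hP.g_proper
  have hzd := hz.ne_top hg
  -- With this step length the quadratic remainder t²/(2μ)‖s - r‖² and the tolerance ε ≤ μτ² are
  -- both multiples of tτ, so division by t leaves an error of order τ.
  set t := μ * τ with ht
  have ht0 : 0 < t := mul_pos hμ hτ
  set r := c x - z with hr
  set s := c x' - v with hs
  have hh := hP.c_convex x' x t ht0.le hτ1
  -- Adding the defect `h` to the convex combination of `v` and `z` does not increase `g` and makes
  -- the residual exactly affine in t.
  set h := c (t • x' + (1 - t) • x) - t • c x' - (1 - t) • c x with hh'
  have hgt := IsConvexFun.le_combo hg hP.g_convex hv hzd ht0.le hτ1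
  have hgh := (hh _ (ne_top_of_le_coe hgt)).trans hgt
  have hG := hg.toReal_le hgh
  have hmin := approx_min_joint hg hμ hsub hz (t • x' + (1 - t) • x) (ne_top_of_le_coe hgh)
  have hfc := hP.f_convex.2 (Set.mem_univ x') (Set.mem_univ x) ht0.le (sub_nonneg.2 hτ1) (by ring)
  have hres : c (t • x' + (1 - t) • x) - (t • v + (1 - t) • z + h) = r + t • (s - r) := by
    rw [hh', hr, hs]; module
  rw [hres, ← hr] at hmin
  rw [inner_add_right, inner_smul_right, norm_add_sq_real, norm_smul, inner_smul_right,
    Real.norm_of_nonneg ht0.le] at hmin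
  simp only [smul_eq_mul] at hfc
  have hkey : t * (f x + (g z).toReal) ≤ t * (f x' + (g v).toReal + inner ℝ y (s - r)
      + μ⁻¹ * inner ℝ r (s - r) + τ * (1 + ‖s - r‖ ^ 2 / 2)) := by
    have e1 : 1 / (2 * μ) * (‖r‖ ^ 2 + 2 * (t * inner ℝ r (s - r)) + (t * ‖s - r‖) ^ 2)
        = 1 / (2 * μ) * ‖r‖ ^ 2 + t * (μ⁻¹ * inner ℝ r (s - r))
          + t * (τ * (‖s - r‖ ^ 2 / 2)) := by
      rw [ht]; field_simp
    have e2 : μ * τ ^ 2 = t * τ := by rw [ht]; ring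
    rw [e1] at hmin
    rw [e2] at hετ
    nlinarith
  have hfin := le_of_mul_le_mul_left hkey ht0
  simp only [inner_add_left, real_inner_smul_left, inner_sub_right] at hfin ⊢
  linarith

/-- The inexact multiplier step does not increase the distance to a multiplier, up to the
inner tolerance. -/
theorem penalty_gap_le (hP : FullyConvex f g c) {xs : Vec n} (hxs : g (c xs) ≠ ⊤) {ybar : Vec m}
    (hy : ybar ∈ multipliers f g c xs) {μ ε : ℝ} (hμ : 0 < μ) {x : Vec n} {y z : Vec m}
    (hsub : augLagrangian f g c μ x y ≤ (⨅ x', augLagrangian f g c μ x' y) + (ε : EReal))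
    (hz : IsProx g μ (c x + μ • y) z) :
    inner ℝ (y - ybar) (c x - z) + 1 / (2 * μ) * ‖c x - z‖ ^ 2 ≤ ε := by
  have h1 := (mem_multipliers_iff hP hxs).1 hy x z (hz.ne_top hP.g_proper)
  have h2 := approx_min_joint hP.g_proper hμ hsub hz xs hxs
  simp only [sub_self, inner_zero_right, norm_zero] at h2
  rw [inner_sub_left]
  linarith

/-- Multiplied by 2/μ, the hypothesis bounds precisely the increment of the squared distance. -/
theorem sq_dist_multiplier_step {E : Type*} [NormedAddCommGroup E] [InnerProductSpace ℝ E]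
    {μ ε : ℝ} (hμ : 0 < μ) {y ybar r : E}
    (h : inner ℝ (y - ybar) r + 1 / (2 * μ) * ‖r‖ ^ 2 ≤ ε) :
    ‖y + μ⁻¹ • r - ybar‖ ^ 2 ≤ ‖y - ybar‖ ^ 2 + 2 * (ε / μ) := by
  have e : y + μ⁻¹ • r - ybar = (y - ybar) + μ⁻¹ • r := by module
  rw [e, norm_add_sq_real, norm_smul, inner_smul_right, Real.norm_of_nonneg (inv_pos.2 hμ).le]
  have h' := mul_le_mul_of_nonneg_left h (by positivity : 0 ≤ 2 * μ⁻¹)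
  have e2 : 2 * μ⁻¹ * (inner ℝ (y - ybar) r + 1 / (2 * μ) * ‖r‖ ^ 2) =
    2 * (μ⁻¹ * inner ℝ (y - ybar) r) + (μ⁻¹ * ‖r‖) ^ 2 := by field_simp
  have e3 : 2 * μ⁻¹ * ε = 2 * (ε / μ) := by field_simp
  linarith

theorem IsProj.norm_sub_le {C : Set (Vec m)} (hC : Convex ℝ C) {y p w : Vec m}
    (hp : IsProj C y p) (hw : w ∈ C) : ‖p - w‖ ≤ ‖y - w‖ := by
  have hin : inner ℝ (y - p) (w - p) ≤ 0 := by
    refine (norm_eq_iInf_iff_real_inner_le_zero hC hp.1).1 ?_ w hw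
    have : Nonempty C := ⟨⟨p, hp.1⟩⟩
    refine le_antisymm (le_ciInf fun v => ?_) ?_
    · rw [norm_sub_rev, norm_sub_rev y]
      exact hp.2 v v.2
    · exact ciInf_le (f := fun v : C => ‖y - v‖)
        ⟨0, by rintro _ ⟨v, rfl⟩; exact norm_nonneg _⟩ ⟨p, hp.1⟩
  have e : y - w = (y - p) - (w - p) := by abel
  refine (sq_le_sq₀ (norm_nonneg _) (norm_nonneg _)).1 ?_
  rw [e, norm_sub_sq_real (y - p), norm_sub_rev p w]
  nlinarith [sq_nonneg ‖y - p‖]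

end Step

/-! ### Auxiliary facts on sequences and norms. -/

/-- A nonnegative sequence that eventually decreases up to summable errors converges. -/
theorem exists_tendsto_of_le_add_summable {d e : ℕ → ℝ} (hd : ∀ k, 0 ≤ d k) (he : ∀ k, 0 ≤ e k)
    (hs : Summable e) (h : ∀ᶠ k in atTop, d (k + 1) ≤ d k + e k) :
    ∃ l, Tendsto d atTop (𝓝 l) := by
  obtain ⟨N, hN⟩ := eventually_atTop.1 h
  set S : ℕ → ℝ := fun k => ∑ i ∈ Finset.range k, e i with hS
  -- Subtracting the accumulated errors restores monotonicity.
  have hanti : Antitone fun k => d (k + N) - S (k + N) := by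
    refine antitone_nat_of_succ_le fun k => ?_
    have h1 := hN (k + N) (by omega)
    have h2 : S (k + N + 1) = S (k + N) + e (k + N) := Finset.sum_range_succ _ _
    rw [show k + 1 + N = k + N + 1 by omega]
    linarith
  have hbdd : BddBelow (Set.range fun k => d (k + N) - S (k + N)) := by
    refine ⟨-∑' i, e i, ?_⟩
    rintro _ ⟨k, rfl⟩
    have h1 : S (k + N) ≤ ∑' i, e i := hs.sum_le_tsum _ fun i _ => he i
    have h2 := hd (k + N)
    simp only
    linarith
  have h1 := (tendsto_add_atTop_iff_nat (f := fun k => d k - S k) N).1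
    (tendsto_atTop_ciInf hanti hbdd)
  exact ⟨_, (h1.add hs.hasSum.tendsto_sum_nat).congr fun k => by simp [hS]⟩

theorem exists_norm_le_mul_maxNorm (m : ℕ) : ∃ C : ℝ, 0 ≤ C ∧ ∀ v : Vec m, ‖v‖ ≤ C * maxNorm v := by
  refine ⟨‖((PiLp.continuousLinearEquiv 2 ℝ fun _ : Fin m => ℝ).symm :
    (Fin m → ℝ) →L[ℝ] Vec m)‖, norm_nonneg _, fun v => ?_⟩
  exact ((PiLp.continuousLinearEquiv 2 ℝ fun _ : Fin m => ℝ).symm :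
    (Fin m → ℝ) →L[ℝ] Vec m).le_opNorm (WithLp.ofLp v)

/-! ### Asymptotics of the generated sequences. -/

section Run

variable {n m : ℕ} {f : Vec n → ℝ} {g : Vec m → EReal} {c : Vec n → Vec m}
  {Ysg : Set (Vec m)} {θ η β : ℝ} {x : ℕ → Vec n} {z y yhat : ℕ → Vec m} {ε μ ρ : ℕ → ℝ}

namespace IsElasticALMRun

open Classical in
/-- The parameters are determined by the number of rejected steps. -/
theorem parameters_eq (hrun : IsElasticALMRun f g c Ysg θ η β x z y yhat ε μ ρ) (k : ℕ) :
    μ k = μ 0 * β ^ Nat.count (fun k => ¬ Accepts θ (fun j => maxNorm (c (x j) - z j)) k) k ∧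
      ρ k = (η / β) ^ Nat.count (fun k => ¬ Accepts θ (fun j => maxNorm (c (x j) - z j)) k) k := by
  induction k with
  | zero => simp [hrun.rho_zero]
  | succ k ih =>
    rw [Nat.count_succ]
    by_cases h : Accepts θ (fun j => maxNorm (c (x j) - z j)) k
    · obtain ⟨h1, h2⟩ := hrun.accept k h
      rw [h1, h2, if_neg (not_not.2 h)]
      exact ih
    · obtain ⟨h1, h2⟩ := hrun.reject k h
      rw [h1, h2, if_pos h, pow_succ, pow_succ, ih.1, ih.2]
      exact ⟨by ring, by ring⟩

theorem mu_pos (hrun : IsElasticALMRun f g c Ysg θ η β x z y yhat ε μ ρ) (hμ0 : 0 < μ 0)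
    (hβ : 0 < β) (k : ℕ) : 0 < μ k := by
  rw [(hrun.parameters_eq k).1]
  positivity

theorem mu_le (hrun : IsElasticALMRun f g c Ysg θ η β x z y yhat ε μ ρ) (hμ0 : 0 < μ 0)
    (hβ : 0 < β) (hβ1 : β ≤ 1) (k : ℕ) : μ k ≤ μ 0 := by
  rw [(hrun.parameters_eq k).1]
  exact mul_le_of_le_one_right hμ0.le (pow_le_one₀ hβ.le hβ1)

theorem rho_pos (hrun : IsElasticALMRun f g c Ysg θ η β x z y yhat ε μ ρ) (hη : 0 < η)
    (hβ : 0 < β) (k : ℕ) : 0 < ρ k := by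
  rw [(hrun.parameters_eq k).2]
  positivity

/-- Each rejection multiplies μ, ρ, μρ and μρ² by β, η/β, η and η²/β; the bounds η² < β < η < 1
decide all four limits. -/
theorem tendsto_parameters (hrun : IsElasticALMRun f g c Ysg θ η β x z y yhat ε μ ρ)
    (hη : η ∈ Set.Ioo (0 : ℝ) 1) (hβ : β ∈ Set.Ioo (η ^ 2) η)
    (hrej : ∃ᶠ k in atTop, ¬ Accepts θ (fun j => maxNorm (c (x j) - z j)) k) :
    Tendsto μ atTop (𝓝 0) ∧ Tendsto ρ atTop atTop ∧ Tendsto (fun k => μ k * ρ k) atTop (𝓝 0) ∧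
      Tendsto (fun k => μ k * ρ k ^ 2) atTop (𝓝 0) := by
  classical
  have hβ0 : 0 < β := (pow_pos hη.1 2).trans hβ.1
  set p : ℕ → Prop := fun k => ¬ Accepts θ (fun j => maxNorm (c (x j) - z j)) k with hp
  have hcount : Tendsto (Nat.count p) atTop atTop := by
    refine tendsto_atTop_atTop_of_monotone (Nat.count_monotone p) fun b => ?_
    exact ⟨Nat.nth p b, (Nat.count_nth_of_infinite
      (Nat.frequently_atTop_iff_infinite.1 hrej) b).ge⟩
  have hpow : ∀ q : ℝ, 0 ≤ q → q < 1 →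
      Tendsto (fun k => μ 0 * q ^ Nat.count p k) atTop (𝓝 0) := fun q h0 h1 => by
    simpa using ((tendsto_pow_atTop_nhds_zero_of_lt_one h0 h1).comp hcount).const_mul (μ 0)
  refine ⟨?_, ?_, ?_, ?_⟩
  · exact (hpow β hβ0.le (hβ.2.trans hη.2)).congr fun k => (hrun.parameters_eq k).1.symm
  · exact ((tendsto_pow_atTop_atTop_of_one_lt ((one_lt_div hβ0).2 hβ.2)).comp hcount).congr
      fun k => (hrun.parameters_eq k).2.symm
  · refine (hpow η hη.1.le hη.2).congr fun k => ?_
    rw [(hrun.parameters_eq k).1, (hrun.parameters_eq k).2, mul_assoc, ← mul_pow,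
      mul_div_cancel₀ _ hβ0.ne']
  · refine (hpow (η ^ 2 / β) (by positivity) ((div_lt_one hβ0).2 hβ.1)).congr fun k => ?_
    rw [(hrun.parameters_eq k).1, (hrun.parameters_eq k).2, mul_assoc, ← pow_mul, mul_comm _ 2,
      pow_mul, ← mul_pow]
    congr 2
    field_simp

theorem exists_norm_yhat_le (hrun : IsElasticALMRun f g c Ysg θ η β x z y yhat ε μ ρ)
    (hη : 0 < η) (hβ : 0 < β) (hY : IsCompact Ysg) : ∃ C : ℝ, ∀ k, ‖yhat k‖ ≤ ρ k * C := by
  obtain ⟨C, hC⟩ := hY.isBounded.exists_norm_le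
  refine ⟨C, fun k => ?_⟩
  obtain ⟨w, hw, he⟩ := (hrun.safeguard k).1
  have hρ := (hrun.rho_pos hη hβ k).le
  rw [← he]
  simp only [norm_smul, Real.norm_of_nonneg hρ]
  exact mul_le_mul_of_nonneg_left (hC w hw) hρ

theorem eps_eq (hrun : IsElasticALMRun f g c Ysg θ η β x z y yhat ε μ ρ) (hμ : ∀ k, 0 < μ k)
    (k : ℕ) : ε k = μ k * Real.sqrt (ε k / μ k) ^ 2 := by
  rw [Real.sq_sqrt (div_nonneg (hrun.eps_nonneg k) (hμ k).le), mul_div_cancel₀ _ (hμ k).ne']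

theorem tendsto_eps (hrun : IsElasticALMRun f g c Ysg θ η β x z y yhat ε μ ρ)
    (hμ : ∀ k, 0 < μ k) (hle : ∀ k, μ k ≤ μ 0)
    (hsum : Summable fun k => Real.sqrt (ε k / μ k)) : Tendsto ε atTop (𝓝 0) := by
  have h : Tendsto (fun k => μ 0 * Real.sqrt (ε k / μ k) ^ 2) atTop (𝓝 0) := by
    simpa using (hsum.tendsto_atTop_zero.pow 2).const_mul (μ 0)
  refine squeeze_zero hrun.eps_nonneg (fun k => ?_) h
  conv_lhs => rw [hrun.eps_eq hμ k]
  exact mul_le_mul_of_nonneg_right (hle k) (by positivity)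

/-- Limits of the dual iterates are multipliers once the infeasibility vanishes. -/
theorem mem_multipliers_of_tendsto (hrun : IsElasticALMRun f g c Ysg θ η β x z y yhat ε μ ρ)
    (hP : FullyConvex f g c) {xs : Vec n} (hxs : g (c xs) ≠ ⊤)
    (hstat : IsStationary f g c xs) (hμ : ∀ k, 0 < μ k) (hle : ∀ k, μ k ≤ μ 0)
    (hsum : Summable fun k => Real.sqrt (ε k / μ k))
    (hr : Tendsto (fun k => c (x k) - z k) atTop (𝓝 0)) {φ : ℕ → ℕ} (hφ : Tendsto φ atTop atTop)
    {ybar : Vec m} (hy : Tendsto (fun j => y (φ j + 1)) atTop (𝓝 ybar)) :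
    ybar ∈ multipliers f g c xs := by
  obtain ⟨ys, hys⟩ := hstat
  refine (mem_multipliers_iff hP hxs).2 fun x' v hv => ?_
  -- The extra 1/(k+1) keeps τ positive even when `ε k = 0`.
  set τ : ℕ → ℝ := fun k => Real.sqrt (ε k / μ k) + 1 / ((k : ℝ) + 1) with hτdef
  have hτ : Tendsto τ atTop (𝓝 0) := by
    simpa [hτdef] using hsum.tendsto_atTop_zero.add (tendsto_one_div_add_atTop_nhds_zero_nat (𝕜 := ℝ))
  have hτpos : ∀ k, 0 < τ k := fun k =>
    add_pos_of_nonneg_of_pos (Real.sqrt_nonneg _) Nat.one_div_pos_of_nat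
  have hsmall : ∀ᶠ k in atTop, μ k * τ k ≤ 1 := by
    have h : Tendsto (fun k => μ 0 * τ k) atTop (𝓝 0) := by simpa using hτ.const_mul (μ 0)
    filter_upwards [h.eventually_le_const one_pos] with k hk
    exact (mul_le_mul_of_nonneg_right (hle k) (hτpos k).le).trans hk
  have hr' := hr.comp hφ
  have hτ' := hτ.comp hφ
  -- The known multiplier `ys` bounds f(x^k) + g(z^k) from below, so the primal iterates need not
  -- converge.
  have hL : Tendsto (fun j => f xs + (g (c xs)).toReal
      - inner ℝ ys (c (x (φ j)) - z (φ j)) + inner ℝ (y (φ j + 1)) (c (x (φ j)) - z (φ j)))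
      atTop (𝓝 (f xs + (g (c xs)).toReal - inner ℝ ys (0 : Vec m) + inner ℝ ybar (0 : Vec m))) :=
    (tendsto_const_nhds.sub (tendsto_const_nhds.inner hr')).add (hy.inner hr')
  have hR : Tendsto (fun j => f x' + (g v).toReal + inner ℝ (y (φ j + 1)) (c x' - v)
      + τ (φ j) * (1 + ‖(c x' - v) - (c (x (φ j)) - z (φ j))‖ ^ 2 / 2)) atTop
      (𝓝 (f x' + (g v).toReal + inner ℝ ybar (c x' - v)
        + 0 * (1 + ‖(c x' - v) - 0‖ ^ 2 / 2))) :=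
    (tendsto_const_nhds.add (hy.inner tendsto_const_nhds)).add
      (hτ'.mul (tendsto_const_nhds.add (((tendsto_const_nhds.sub hr').norm.pow 2).div_const 2)))
  have hlim := le_of_tendsto_of_tendsto hL hR ?_
  · simpa only [inner_zero_right, sub_zero, add_zero, zero_mul] using hlim
  · filter_upwards [hφ.eventually hsmall] with j hj
    have hετ : ε (φ j) ≤ μ (φ j) * τ (φ j) ^ 2 := by
      conv_lhs => rw [hrun.eps_eq hμ (φ j)]
      refine mul_le_mul_of_nonneg_left (pow_le_pow_left₀ (Real.sqrt_nonneg _) ?_ 2) (hμ _).le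
      exact le_add_of_nonneg_right Nat.one_div_pos_of_nat.le
    have h1 := approx_min_lagrangian hP (hμ (φ j)) (hrun.subproblem _) (hrun.prox_step _)
      (hτpos _) hετ hj x' hv
    have h2 := (mem_multipliers_iff hP hxs).1 hys (x (φ j)) (z (φ j))
      ((hrun.prox_step _).ne_top hP.g_proper)
    rw [← hrun.dual_step] at h1
    linarith

/-- If all but finitely many steps are accepted, the residuals decay geometrically and both dual
sequences converge to the same limit. -/
theorem tendsto_of_eventually_accepts
    (hrun : IsElasticALMRun f g c Ysg θ η β x z y yhat ε μ ρ) (hθ : θ ∈ Set.Ioo (0 : ℝ) 1)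
    (hμ : ∀ k, 0 < μ k)
    (hacc : ∀ᶠ k in atTop, Accepts θ (fun j => maxNorm (c (x j) - z j)) k) :
    Tendsto (fun k => c (x k) - z k) atTop (𝓝 0) ∧
      ∃ ybar, Tendsto y atTop (𝓝 ybar) ∧ Tendsto yhat atTop (𝓝 ybar) := by
  obtain ⟨N, hN⟩ := eventually_atTop.1 hacc
  set V : ℕ → ℝ := fun j => maxNorm (c (x j) - z j) with hV
  have hpar : ∀ k, μ (k + N) = μ N ∧ ρ (k + N) = ρ N := fun k => by
    induction k with
    | zero => simp
    | succ k ih =>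
      have h := hrun.accept (k + N) (hN _ (by omega))
      rw [show k + 1 + N = k + N + 1 by omega, h.1, h.2]
      exact ih
  have hVg : ∀ k, V (k + N) ≤ V N * θ ^ k := fun k => by
    induction k with
    | zero => simp
    | succ k ih =>
      -- The free acceptance at index 0 cannot be the reason here, since the index is positive.
      rcases hN (k + 1 + N) (by omega) with h | h
      · omega
      · rw [show k + 1 + N - 1 = k + N by omega] at h
        calc V (k + 1 + N) ≤ θ * V (k + N) := h
          _ ≤ θ * (V N * θ ^ k) := mul_le_mul_of_nonneg_left ih hθ.1.le
          _ = V N * θ ^ (k + 1) := by ring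
  obtain ⟨C, hC0, hC⟩ := exists_norm_le_mul_maxNorm m
  have hrg : ∀ k, ‖c (x (k + N)) - z (k + N)‖ ≤ C * V N * θ ^ k := fun k =>
    (hC _).trans ((mul_le_mul_of_nonneg_left (hVg k) hC0).trans (mul_assoc _ _ _).ge)
  have hgeo : ∀ A : ℝ, Tendsto (fun k : ℕ => A * θ ^ k) atTop (𝓝 0) := fun A => by
    simpa using (tendsto_pow_atTop_nhds_zero_of_lt_one hθ.1.le hθ.2).const_mul A
  have hr : Tendsto (fun k => c (x k) - z k) atTop (𝓝 0) :=
    (tendsto_add_atTop_iff_nat N).1 (squeeze_zero_norm hrg (hgeo _))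
  refine ⟨hr, ?_⟩
  have hstep : ∀ k, ‖yhat (k + N) - y (k + N + 1)‖ ≤ (μ N)⁻¹ * (C * V N) * θ ^ k := fun k => by
    rw [hrun.dual_step, sub_add_cancel_left, norm_neg, norm_smul, (hpar k).1,
      Real.norm_of_nonneg (inv_pos.2 (hμ N)).le, mul_assoc]
    exact mul_le_mul_of_nonneg_left (hrg k) (inv_pos.2 (hμ N)).le
  have hproj : ∀ k, ‖yhat (k + 1 + N) - y (k + N + 1)‖ ≤ ‖yhat (k + N) - y (k + N + 1)‖ :=
    fun k => by
      have h := hrun.safeguard (k + 1 + N)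
      -- The safeguard is frozen, so the previous projection competes in the next one.
      have hmem : yhat (k + N) ∈ ρ (k + 1 + N) • Ysg := by
        rw [(hpar (k + 1)).2, ← (hpar k).2]
        exact (hrun.safeguard (k + N)).1
      have h2 := h.2 _ hmem
      rwa [show y (k + 1 + N) = y (k + N + 1) by congr 1; omega] at h2
  have hcauchy : CauchySeq fun k => yhat (k + N) := by
    refine cauchySeq_of_le_geometric θ (2 * ((μ N)⁻¹ * (C * V N))) hθ.2 fun k => ?_
    rw [dist_eq_norm]
    have e : yhat (k + N) - yhat (k + 1 + N) = (yhat (k + N) - y (k + N + 1))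
        - (yhat (k + 1 + N) - y (k + N + 1)) := by abel
    rw [e]
    have h1 := norm_sub_le (yhat (k + N) - y (k + N + 1)) (yhat (k + 1 + N) - y (k + N + 1))
    have h2 := hstep k
    have h3 := hproj k
    linarith
  obtain ⟨ybar, hybar⟩ := cauchySeq_tendsto_of_complete hcauchy
  refine ⟨ybar, ?_, (tendsto_add_atTop_iff_nat N).1 hybar⟩
  have hdiff := hybar.sub (squeeze_zero_norm hstep (hgeo _))
  refine (tendsto_add_atTop_iff_nat (N + 1)).1 ?_
  simpa [add_assoc] using hdiff

/-- Vanishing infeasibility and asymptotic optimality when infinitely many steps are rejected. -/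
theorem tendsto_of_frequently_rejects
    (hrun : IsElasticALMRun f g c Ysg θ η β x z y yhat ε μ ρ) (hP : FullyConvex f g c)
    {xs : Vec n} (hxs : g (c xs) ≠ ⊤) (hstat : IsStationary f g c xs) (hY : IsCompact Ysg)
    (hη : η ∈ Set.Ioo (0 : ℝ) 1) (hβ : β ∈ Set.Ioo (η ^ 2) η) (hμ : ∀ k, 0 < μ k)
    (hε : Tendsto ε atTop (𝓝 0))
    (hrej : ∃ᶠ k in atTop, ¬ Accepts θ (fun j => maxNorm (c (x j) - z j)) k) :
    Tendsto (fun k => c (x k) - z k) atTop (𝓝 0) ∧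
      Tendsto (fun k => μ k / 2 * ‖yhat k‖ ^ 2) atTop (𝓝 0) := by
  obtain ⟨ys, hys⟩ := hstat
  have hβ0 : 0 < β := (pow_pos hη.1 2).trans hβ.1
  obtain ⟨C, hC⟩ := hrun.exists_norm_yhat_le hη.1 hβ0 hY
  obtain ⟨hμ0, -, hμρ, hμρ2⟩ := hrun.tendsto_parameters hη hβ hrej
  constructor
  -- With a = μ‖ŷ - ys‖, the gap estimate reads ‖r‖² ≤ 2με + 2a‖r‖; Young's inequality absorbs
  -- ‖r‖²/2 and gives 4με + 4a².
  · have hB : Tendsto (fun k => 4 * (μ k * ε k) + 4 * (μ k * ρ k * C + μ k * ‖ys‖) ^ 2) atTop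
        (𝓝 0) := by
      simpa using ((hμ0.mul hε).const_mul 4).add
        ((((hμρ.mul_const C).add (hμ0.mul_const ‖ys‖)).pow 2).const_mul 4)
    have hsq : Tendsto (fun k => ‖c (x k) - z k‖ ^ 2) atTop (𝓝 0) := by
      refine squeeze_zero (fun k => sq_nonneg _) (fun k => ?_) hB
      have h1 := penalty_gap_le hP hxs hys (hμ k) (hrun.subproblem k) (hrun.prox_step k)
      set r := c (x k) - z k
      have h2 := neg_le_of_abs_le (abs_real_inner_le_norm (yhat k - ys) r)
      have h3 : μ k * ‖yhat k - ys‖ ≤ μ k * ρ k * C + μ k * ‖ys‖ := by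
        have := (norm_sub_le (yhat k) ys).trans (add_le_add (hC k) le_rfl)
        have := mul_le_mul_of_nonneg_left this (hμ k).le
        linarith
      have h4 : (μ k * ‖yhat k - ys‖) ^ 2 ≤ (μ k * ρ k * C + μ k * ‖ys‖) ^ 2 :=
        pow_le_pow_left₀ (mul_nonneg (hμ k).le (norm_nonneg _)) h3 2
      have h5 := mul_le_mul_of_nonneg_left ((add_le_add h2 le_rfl).trans h1)
        (by linarith [hμ k] : 0 ≤ 2 * μ k)
      have e : 2 * μ k * (-(‖yhat k - ys‖ * ‖r‖) + 1 / (2 * μ k) * ‖r‖ ^ 2)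
          = ‖r‖ ^ 2 - 2 * (μ k * ‖yhat k - ys‖) * ‖r‖ := by
        have := (hμ k).ne'
        field_simp
        ring
      rw [e] at h5
      linarith [sq_nonneg (‖r‖ - 2 * (μ k * ‖yhat k - ys‖))]
    rw [tendsto_zero_iff_norm_tendsto_zero]
    simpa [Real.sqrt_sq (norm_nonneg _)] using hsq.sqrt
  · have hB : Tendsto (fun k => μ k * ρ k ^ 2 * (C ^ 2 / 2)) atTop (𝓝 0) := by
      simpa using hμρ2.mul_const (C ^ 2 / 2)
    refine squeeze_zero (fun k => by have := hμ k; positivity) (fun k => ?_) hB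
    have h1 := pow_le_pow_left₀ (norm_nonneg _) (hC k) 2
    have h2 := mul_le_mul_of_nonneg_left h1 (hμ k).le
    linarith [h2, mul_pow (ρ k) C 2, mul_assoc (μ k) (ρ k ^ 2) (C ^ 2),
      congrArg (μ k * ·) (mul_pow (ρ k) C 2)]

/-- Quasi-Fejér monotonicity: if the safeguarding sets eventually capture all multipliers, then
the dual iterates converge to a multiplier. -/
theorem tendsto_multiplier_of_capture
    (hrun : IsElasticALMRun f g c Ysg θ η β x z y yhat ε μ ρ) (hP : FullyConvex f g c)
    {xs : Vec n} (hxs : g (c xs) ≠ ⊤) (hstat : IsStationary f g c xs) (hY : Convex ℝ Ysg)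
    (hμ : ∀ k, 0 < μ k) (hle : ∀ k, μ k ≤ μ 0)
    (hsum : Summable fun k => Real.sqrt (ε k / μ k))
    (hr : Tendsto (fun k => c (x k) - z k) atTop (𝓝 0))
    (hcap : ∀ ybar ∈ multipliers f g c xs, ∀ᶠ k in atTop, ybar ∈ ρ k • Ysg) :
    ∃ ybar ∈ multipliers f g c xs, Tendsto y atTop (𝓝 ybar) := by
  have hdist : ∀ ybar ∈ multipliers f g c xs, ∃ l,
      Tendsto (fun k => ‖y k - ybar‖) atTop (𝓝 l) := fun ybar hybar => by
    refine exists_tendsto_of_le_add_summable (fun k => norm_nonneg _)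
      (fun k => mul_nonneg zero_le_two (Real.sqrt_nonneg _)) (hsum.mul_left 2) ?_
    filter_upwards [hcap ybar hybar] with k hk
    have h1 := (hrun.safeguard k).norm_sub_le (hY.smul _) hk
    have h2 := sq_dist_multiplier_step (hμ k)
      (penalty_gap_le hP hxs hybar (hμ k) (hrun.subproblem k) (hrun.prox_step k))
    rw [← hrun.dual_step, ← Real.sq_sqrt (div_nonneg (hrun.eps_nonneg k) (hμ k).le)] at h2
    have hσ := Real.sqrt_nonneg (ε k / μ k)
    set σ := Real.sqrt (ε k / μ k)
    -- From squares to norms: d² + 2σ² ≤ (d + 2σ)².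
    refine (?_ : ‖y (k + 1) - ybar‖ ≤ ‖yhat k - ybar‖ + 2 * σ).trans (by linarith)
    refine (sq_le_sq₀ (norm_nonneg _) (by positivity)).1 (h2.trans ?_)
    nlinarith [mul_nonneg (norm_nonneg (yhat k - ybar)) hσ, sq_nonneg σ]
  obtain ⟨ys, hys⟩ := hstat
  obtain ⟨l, hl⟩ := hdist ys hys
  obtain ⟨B, hB⟩ := hl.bddAbove_range
  obtain ⟨ybar, -, φ, hφ, hlim⟩ := tendsto_subseq_of_bounded (x := fun k => y (k + 1))
    (Metric.isBounded_closedBall (x := ys) (r := B)) fun k => by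
      rw [mem_closedBall_iff_norm]
      exact hB ⟨k + 1, rfl⟩
  have hmem := hrun.mem_multipliers_of_tendsto hP hxs ⟨ys, hys⟩ hμ hle hsum hr
    hφ.tendsto_atTop hlim
  refine ⟨ybar, hmem, ?_⟩
  -- The cluster point is itself a multiplier, so its distance to the whole sequence converges; a
  -- subsequence forces the limit 0.
  obtain ⟨l', hlim2⟩ := hdist ybar hmem
  have h1 : Tendsto (fun j => ‖y (φ j + 1) - ybar‖) atTop (𝓝 l') :=
    hlim2.comp ((tendsto_add_atTop_nat 1).comp hφ.tendsto_atTop)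
  have h2 : Tendsto (fun j => ‖y (φ j + 1) - ybar‖) atTop (𝓝 0) :=
    tendsto_iff_norm_sub_tendsto_zero.1 hlim
  rw [tendsto_nhds_unique h1 h2] at hlim2
  exact tendsto_iff_norm_sub_tendsto_zero.2 hlim2

/-- Asymptotic feasibility and optimality of the primal iterates. -/
theorem tendsto_residual_and_value_le
    (hrun : IsElasticALMRun f g c Ysg θ η β x z y yhat ε μ ρ) (hP : FullyConvex f g c)
    {xs : Vec n} (hxs : g (c xs) ≠ ⊤) (hstat : IsStationary f g c xs) (hY : IsCompact Ysg)
    (hθ : θ ∈ Set.Ioo (0 : ℝ) 1) (hη : η ∈ Set.Ioo (0 : ℝ) 1) (hβ : β ∈ Set.Ioo (η ^ 2) η)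
    (hμ : ∀ k, 0 < μ k) (hε : Tendsto ε atTop (𝓝 0)) :
    Tendsto (fun k => c (x k) - z k) atTop (𝓝 0) ∧
      ∃ δ : ℕ → ℝ, Tendsto δ atTop (𝓝 0) ∧
        ∀ k, f (x k) + (g (z k)).toReal ≤ f xs + (g (c xs)).toReal + δ k := by
  have hval : ∀ k, f (x k) + (g (z k)).toReal + inner ℝ (yhat k) (c (x k) - z k)
      + 1 / (2 * μ k) * ‖c (x k) - z k‖ ^ 2 ≤ f xs + (g (c xs)).toReal + ε k := fun k => by
    simpa using approx_min_joint hP.g_proper (hμ k) (hrun.subproblem k) (hrun.prox_step k) xs hxs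
  by_cases hacc : ∀ᶠ k in atTop, Accepts θ (fun j => maxNorm (c (x j) - z j)) k
  · obtain ⟨hr, ybar, -, hyhat⟩ := hrun.tendsto_of_eventually_accepts hθ hμ hacc
    refine ⟨hr, fun k => ε k - inner ℝ (yhat k) (c (x k) - z k), ?_, fun k => ?_⟩
    · simpa using hε.sub (hyhat.inner hr)
    · have h1 := hval k
      have h2 : 0 ≤ 1 / (2 * μ k) * ‖c (x k) - z k‖ ^ 2 := by have := hμ k; positivity
      linarith
  · obtain ⟨hr, hq⟩ := hrun.tendsto_of_frequently_rejects hP hxs hstat hY hη hβ hμ hε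
      (not_eventually.1 hacc)
    refine ⟨hr, fun k => ε k + μ k / 2 * ‖yhat k‖ ^ 2, by simpa using hε.add hq, fun k => ?_⟩
    have h1 := hval k
    -- Here ŷ may be unbounded; completing the square bounds the multiplier and penalty terms below
    -- by -μ‖ŷ‖²/2, which vanishes.
    have h2 := prox_quadratic_expand (hμ k) (c (x k)) (z k) (yhat k)
    have h3 : 0 ≤ 1 / (2 * μ k) * ‖z k - (c (x k) + μ k • yhat k)‖ ^ 2 := by
      have := hμ k; positivity
    linarith

end IsElasticALMRun

end Run

end CompositeALM

/-! ### Assembly of the four claims. -/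

theorem theorem6p2 {n m : ℕ}
    (f : CompositeALM.Vec n → ℝ) (g : CompositeALM.Vec m → EReal)
    (c : CompositeALM.Vec n → CompositeALM.Vec m)
    (hP : CompositeALM.FullyConvex f g c)
    -- a stationary minimizer, whose multiplier set is `Y_mul`
    (xs : CompositeALM.Vec n) (hxs_min : CompositeALM.IsMinimizer f g c xs)
    (hxs_stat : CompositeALM.IsStationary f g c xs)
    -- the data of the method
    (Ysg : Set (CompositeALM.Vec m)) (hY_nonempty : Ysg.Nonempty) (hY_convex : Convex ℝ Ysg)
    (hY_compact : IsCompact Ysg)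
    (θ η β : ℝ) (hθ : θ ∈ Set.Ioo (0 : ℝ) 1) (hη : η ∈ Set.Ioo (0 : ℝ) 1)
    (hβ : β ∈ Set.Ioo (η ^ 2) η)
    -- the generated sequences
    (x : ℕ → CompositeALM.Vec n) (z y yhat : ℕ → CompositeALM.Vec m) (ε μ ρ : ℕ → ℝ)
    (hμ0 : 0 < μ 0)
    (hrun : CompositeALM.IsElasticALMRun f g c Ysg θ η β x z y yhat ε μ ρ)
    (hsum : Summable fun k => Real.sqrt (ε k / μ k)) :
    -- dual convergence; if the penalty parameters tend to zero, the sets `r • Ysg`, `r → ∞`, have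
    -- to grow in such a way that they eventually capture every multiplier
    ((Tendsto μ atTop (𝓝 0) →
        ∀ ybar ∈ CompositeALM.multipliers f g c xs, ∀ᶠ r : ℝ in atTop, ybar ∈ r • Ysg) →
      ∃ ybar ∈ CompositeALM.multipliers f g c xs, Tendsto y atTop (𝓝 ybar)) ∧
    Tendsto (fun k => c (x k) - z k) atTop (𝓝 0) ∧
    limsup (fun k => (f (x k) : EReal) + g (z k)) atTop ≤ CompositeALM.optimalValue f g c ∧
    (∀ xbar, MapClusterPt xbar atTop x → CompositeALM.IsMinimizer f g c xbar) ∧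
    (∀ (xbar : CompositeALM.Vec n) (φ : ℕ → ℕ), StrictMono φ →
      Tendsto (fun j => x (φ j)) atTop (𝓝 xbar) →
        Tendsto (fun j => z (φ j)) atTop (𝓝 (c xbar)) ∧
        Tendsto (fun j => (f (x (φ j)) : EReal) + g (z (φ j))) atTop
          (𝓝 (CompositeALM.optimalValue f g c))) := by
  have hβ0 : 0 < β := (pow_pos hη.1 2).trans hβ.1
  have hμ := hrun.mu_pos hμ0 hβ0
  have hle := hrun.mu_le hμ0 hβ0 (hβ.2.trans hη.2).le
  have hε := hrun.tendsto_eps hμ hle hsum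
  have hg := hP.g_proper
  obtain ⟨hxs, hopt⟩ := CompositeALM.optimalValue_eq hP hxs_min
  obtain ⟨hr, δ, hδ, hub⟩ :=
    hrun.tendsto_residual_and_value_le hP hxs hxs_stat hY_compact hθ hη hβ hμ hε
  have hzdom : ∀ k, g (z k) ≠ ⊤ := fun k => (hrun.prox_step k).ne_top hg
  have hcoe : ∀ k, (f (x k) : EReal) + g (z k) = ((f (x k) + (g (z k)).toReal : ℝ) : EReal) :=
    fun k => by rw [EReal.coe_add, hg.coe_toReal (hzdom k)]
  -- A multiplier supplies the matching lower bound, so the whole sequence of values converges.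
  have hval : Tendsto (fun k => f (x k) + (g (z k)).toReal) atTop
      (𝓝 (f xs + (g (c xs)).toReal)) := by
    obtain ⟨ys, hys⟩ := hxs_stat
    have hlow : Tendsto (fun k => f xs + (g (c xs)).toReal - inner ℝ ys (c (x k) - z k)) atTop
        (𝓝 (f xs + (g (c xs)).toReal)) := by
      simpa using (tendsto_const_nhds (x := f xs + (g (c xs)).toReal)).sub
        ((tendsto_const_nhds (x := ys)).inner hr)
    have hup : Tendsto (fun k => f xs + (g (c xs)).toReal + δ k) atTop
        (𝓝 (f xs + (g (c xs)).toReal)) := by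
      simpa using tendsto_const_nhds.add hδ
    refine tendsto_of_tendsto_of_tendsto_of_le_of_le hlow hup (fun k => ?_) hub
    have := (CompositeALM.mem_multipliers_iff hP hxs).1 hys (x k) (z k) (hzdom k)
    simp only
    linarith
  have hvalE : Tendsto (fun k => (f (x k) : EReal) + g (z k)) atTop
      (𝓝 (CompositeALM.optimalValue f g c)) := by
    simp only [hcoe, hopt]
    exact (continuous_coe_real_ereal.tendsto _).comp hval
  have hz : ∀ (xbar : CompositeALM.Vec n) (φ : ℕ → ℕ), StrictMono φ →
      Tendsto (fun j => x (φ j)) atTop (𝓝 xbar) →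
        Tendsto (fun j => z (φ j)) atTop (𝓝 (c xbar)) := fun xbar φ hφ hx => by
    simpa using ((hP.c_contDiff.continuous.tendsto xbar).comp hx).sub
      (hr.comp hφ.tendsto_atTop)
  refine ⟨fun hcap => ?_, hr, hvalE.limsup_eq.le, fun xbar hx => ?_, fun xbar φ hφ hx =>
    ⟨hz xbar φ hφ hx, hvalE.comp hφ.tendsto_atTop⟩⟩
  · by_cases hacc : ∀ᶠ k in atTop,
        CompositeALM.Accepts θ (fun j => CompositeALM.maxNorm (c (x j) - z j)) k
    · obtain ⟨-, ybar, hy, -⟩ := hrun.tendsto_of_eventually_accepts hθ hμ hacc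
      exact ⟨ybar, hrun.mem_multipliers_of_tendsto hP hxs hxs_stat hμ hle hsum hr tendsto_id
        (hy.comp (tendsto_add_atTop_nat 1)), hy⟩
    · obtain ⟨hμlim, hρ, -, -⟩ := hrun.tendsto_parameters hη hβ (not_eventually.1 hacc)
      exact hrun.tendsto_multiplier_of_capture hP hxs hxs_stat hY_convex hμ hle hsum hr
        fun ybar hy => hρ.eventually (hcap hμlim ybar hy)
  · obtain ⟨φ, hφ, hxφ⟩ := hx.tendsto_subseq
    have hzφ := hz xbar φ hφ hxφ
    -- Lower semicontinuity: a real `a` strictly between the two sides would eventually lie below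
    -- g(z^k), contradicting the limit of the values.
    have hbound : g (c xbar) ≤ ((f xs + (g (c xs)).toReal - f xbar : ℝ) : EReal) := by
      by_contra hlt
      obtain ⟨a, ha1, ha2⟩ := EReal.lt_iff_exists_real_btwn.1 (not_le.1 hlt)
      have hev : ∀ᶠ j in atTop, f (x (φ j)) + a ≤ f (x (φ j)) + (g (z (φ j))).toReal := by
        filter_upwards [hzφ.eventually (hP.g_lsc (c xbar) a ha2)] with j hj
        rw [← hg.coe_toReal (hzdom _), gt_iff_lt, EReal.coe_lt_coe_iff] at hj
        linarith
      have hlim := le_of_tendsto_of_tendsto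
        (((hP.f_contDiff.continuous.tendsto xbar).comp hxφ).add_const a)
        (hval.comp hφ.tendsto_atTop) hev
      have := EReal.coe_lt_coe_iff.1 ha1
      linarith
    have hdom := CompositeALM.ne_top_of_le_coe hbound
    have hobj : CompositeALM.objective f g c xbar ≤ CompositeALM.optimalValue f g c := by
      have := hg.toReal_le hbound
      rw [hopt, CompositeALM.objective, ← hg.coe_toReal hdom, ← EReal.coe_add,
        EReal.coe_le_coe_iff]
      linarith
    exact ⟨CompositeALM.ne_top_of_le_coe (hobj.trans hopt.le),
      fun x' => hobj.trans (iInf_le _ x')⟩
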